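/- Let $k$ be an infinite field, let $n\ge 0$ be an integer, and let $S=\bigoplus_{a\in\mathbb N^n}S_a$ be a commutative $\mathbb N^n$-graded $k$-algebra. Write $S^{(i)}:=S_{e_i}$, where $e_i$ is the $i$-th standard basis vector of $\mathbb N^n$, and assume that $S$ is standard, i.e. $S_{(0,\dots,0)}=k$ and $S$ is generated as a $k$-algebra by $S^{(1)}\cup\dots\cup S^{(n)}$. Let $S^\Delta:=k[S_{(1,\dots,1)}]$ be its diagonal subring. A complete reduction of $S$ of type $r$ is an $n\times r$ matrix $\{x_{ij}\}$ with $x_{ij}\in S^{(i)}$ for all $i,j$ such that, with $X_j:=\prod_{i=1}^n x_{ij}$ for $1\le j\le r$, the ring $S^\Delta$ is a finitely generated module over its subring $k[X_1,\dots,X_r]$. Suppose that the Krull dimension $d:=\dim S^\Delta$ is finite with $d\ge 1$, and that $\{x_{ij}\mid 1\le i\le n,\ 1\le j\le d\}$ and $\{w_{ij}\mid 1\le i\le n,\ 1\le j\le d\}$ are complete reductions of $S$ (of type $d$). Then there is a proper Zariski-closed subset $M\subsetneq k^d$ such that for every $\mathbf v=(v_1,\dots,v_d)\in k^d$, we have $\mathbf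 v\notin M$ if and only if the $n\times d$ matrix $\{x^{\mathbf v}_{ij}\}$ is a complete reduction of $S$, where \[ x^{\mathbf v}_{ij}:=\begin{cases} x_{ij} & \text{if } j<d,\\ \sum_{h=1}^d v_h w_{ih} & \text{if } j=d.\end{cases} \] -/

import Mathlib

namespace MultigradedExchange

/-- The degree-`e_i` part `S^(i)` of an `ℕ^n`-graded algebra `S = ⨁ 𝒜 a`. -/
def unitPart {k S : Type*} [Field k] [CommRing S] [Algebra k S] {n : ℕ}
    (𝒜 : (Fin n → ℕ) → Submodule k S) (i : Fin n) : Submodule k S :=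
  𝒜 (Pi.single i 1)

/-- A standard `ℕ^n`-graded `k`-algebra (the grading itself is `[GradedAlgebra 𝒜]`): the degree
zero part is `k` (embedded by the structure map), and the algebra is generated over `k` by the
union of the `S^(i)`. -/
structure IsStandard {k S : Type*} [Field k] [CommRing S] [Algebra k S] {n : ℕ}
    (𝒜 : (Fin n → ℕ) → Submodule k S) [GradedAlgebra 𝒜] : Prop where
  algebraMap_injective : Function.Injective (algebraMap k S)
  zero_part : (𝒜 0 : Set S) = Set.range (algebraMap k S)
  generated : Algebra.adjoin k (⋃ i, (unitPart 𝒜 i : Set S)) = ⊤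

/-- The diagonal subring `S^Δ = k[S_(1,…,1)]`. -/
def diagonal {k S : Type*} [Field k] [CommRing S] [Algebra k S] {n : ℕ}
    (𝒜 : (Fin n → ℕ) → Submodule k S) : Subalgebra k S :=
  Algebra.adjoin k (𝒜 (fun _ => 1) : Set S)

/-- The subring `k[X_1, …, X_r]`, where `X_j = ∏ i, x i j` is the product of the `j`-th column. -/
def columnAlgebra (k : Type*) {S : Type*} [Field k] [CommRing S] [Algebra k S] {n r : ℕ}
    (x : Fin n → Fin r → S) : Subalgebra k S :=
  Algebra.adjoin k (Set.range fun j : Fin r => ∏ i : Fin n, x i j)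

theorem columnAlgebra_le_diagonal {k S : Type*} [Field k] [CommRing S] [Algebra k S] {n r : ℕ}
    (𝒜 : (Fin n → ℕ) → Submodule k S) [GradedAlgebra 𝒜] (x : Fin n → Fin r → S)
    (hx : ∀ i j, x i j ∈ unitPart 𝒜 i) : columnAlgebra k x ≤ diagonal 𝒜 := by
  refine Algebra.adjoin_mono ?_
  rintro _ ⟨j, rfl⟩
  have h := SetLike.prod_mem_graded 𝒜 (fun i : Fin n => (Pi.single i 1 : Fin n → ℕ))
    (fun i => x i j) (F := Finset.univ) (fun i _ => hx i j)
  rw [Finset.univ_sum_single (fun _ : Fin n => (1 : ℕ))] at h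
  exact h

/-- An `n × r` matrix `x` is a complete reduction of `S` of type `r` if its `i`-th row lies in
`S^(i)` and `S^Δ` is module-finite over `k[X_1, …, X_r]`. -/
def IsCompleteReduction {k S : Type*} [Field k] [CommRing S] [Algebra k S] {n r : ℕ}
    (𝒜 : (Fin n → ℕ) → Submodule k S) [GradedAlgebra 𝒜] (x : Fin n → Fin r → S) : Prop :=
  ∃ hx : ∀ i j, x i j ∈ unitPart 𝒜 i,
    (Subalgebra.inclusion (columnAlgebra_le_diagonal 𝒜 x hx)).Finite

/-- The matrix `x^v`: the last column of `x` is replaced by `(∑ h, v h • w i h)_i`. -/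
def exchangeLast {k S : Type*} [Field k] [CommRing S] [Algebra k S] {n d : ℕ}
    (x w : Fin n → Fin d → S) (v : Fin d → k) : Fin n → Fin d → S :=
  fun i j => if (j : ℕ) + 1 < d then x i j else ∑ h : Fin d, v h • w i h

/-- Zariski-closed subsets of `k^d`: the common zero sets of families of polynomials. -/
def IsZariskiClosed {k : Type*} [Field k] {d : ℕ} (M : Set (Fin d → k)) : Prop :=
  ∃ P : Set (MvPolynomial (Fin d) k), M = {v | ∀ p ∈ P, MvPolynomial.eval v p = 0}

end MultigradedExchange

/-! Let R be the diagonal subring with degree-t part S_(t,…,t); it is Noetherian and generated over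
k by R_1. Graded Nakayama, with a converse by integrality, shows that degree-one elements y_j make R
finite over k[y] exactly when R_1 lies in the radical of (y_j)
(`isCompleteReduction_iff_le_radical`).

Put I = (X_1, …, X_{d-1}) and let Y_v be the product of the new last column. Modulo I, R is integral
over the image of k[T], T ↦ X_d, so R/I has dimension at most one. Hence X_d may be replaced by Y_v
exactly when Y_v avoids the finitely many minimal primes q over I with R_1 ⊄ q
(`degree_one_le_radical_insert`).

Since q is prime, Y_v ∈ q iff some factor ∑ v_h w_ih lies in a linear subspace of S depending on q
and i (`IsStandard.prod_mem_prime_iff`). The bad v thus form a finite union M of linear subspaces of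
k^d. If one of them were k^d, q would contain every column product of w, hence R_1. So all are
proper, and over an infinite field they cannot cover k^d. -/

namespace MultigradedExchange

/-! ### Spanning families in graded algebras -/

section Graded

variable {ι k A : Type*} [CommSemiring k] [Semiring A] [Algebra k A]

/-- A graded family of submodules whose union generates the algebra spans it. -/
theorem iSup_eq_top_of_adjoin_eq_top [AddMonoid ι] (U : ι → Submodule k A) [SetLike.GradedMonoid U]
    {G : Set A} (hG : Algebra.adjoin k G = ⊤) (hGU : ∀ g ∈ G, ∃ i, g ∈ U i) : ⨆ i, U i = ⊤ := by
  refine (Submodule.eq_top_iff').2 fun a => ?_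
  have ha : a ∈ Algebra.adjoin k G := hG ▸ Algebra.mem_top
  induction ha using Algebra.adjoin_induction with
  | mem g hg =>
    obtain ⟨i, hi⟩ := hGU g hg
    exact Submodule.mem_iSup_of_mem i hi
  | algebraMap r =>
    rw [Algebra.algebraMap_eq_smul_one]
    exact Submodule.smul_mem _ _ (Submodule.mem_iSup_of_mem 0 SetLike.GradedOne.one_mem)
  | add x y _ _ hx hy => exact add_mem hx hy
  | mul x y _ _ hx hy =>
    refine Submodule.iSup_induction U (motive := fun x => x * y ∈ ⨆ i, U i) hx ?_ (by simp) ?_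
    · intro i a ha
      refine Submodule.iSup_induction U (motive := fun y => a * y ∈ ⨆ i, U i) hy ?_ (by simp) ?_
      · intro j b hb
        exact Submodule.mem_iSup_of_mem (i + j) (SetLike.GradedMul.mul_mem ha hb)
      · intro b c hb hc
        rw [mul_add]
        exact add_mem hb hc
    · intro b c hb hc
      rw [add_mul]
      exact add_mem hb hc

/-- A spanning family contained componentwise in a decomposition is equal to it. -/
theorem eq_of_le_of_iSup_eq_top [DecidableEq ι] (𝒜 : ι → Submodule k A) [DirectSum.Decomposition 𝒜]
    {U : ι → Submodule k A} (hU : ∀ i, U i ≤ 𝒜 i) (htop : ⨆ i, U i = ⊤) (i : ι) : U i = 𝒜 i := by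
  refine le_antisymm (hU i) fun a ha => ?_
  have key : ∀ s : A, (DirectSum.decompose 𝒜 s i : A) ∈ U i := by
    intro s
    have hs : s ∈ ⨆ i, U i := htop ▸ Submodule.mem_top
    refine Submodule.iSup_induction U (motive := fun s => (DirectSum.decompose 𝒜 s i : A) ∈ U i)
      hs ?_ (by simp) ?_
    · intro j b hb
      by_cases hij : j = i
      · subst hij
        rwa [DirectSum.decompose_of_mem_same 𝒜 (hU j hb)]
      · rw [DirectSum.decompose_of_mem_ne 𝒜 (hU j hb) hij]
        exact zero_mem _
    · intro b c hb hc
      simpa [DirectSum.decompose_add] using add_mem hb hc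
  simpa [DirectSum.decompose_of_mem_same 𝒜 ha] using key a

end Graded

/-! ### Finiteness, radicals and exchange in standard ℕ-graded algebras -/

section StandardGraded

variable {k R : Type*} [Field k] [CommRing R] [Algebra k R] (𝓡 : ℕ → Submodule k R)
  [GradedAlgebra 𝓡]

theorem isHomogeneous_span_of_degree_one {s : Set R} (hs : ∀ a ∈ s, a ∈ 𝓡 1) :
    (Ideal.span s).IsHomogeneous 𝓡 :=
  Ideal.homogeneous_span _ _ fun a ha => ⟨1, hs a ha⟩

/-- Minimal primes over a homogeneous ideal are homogeneous. -/
theorem isHomogeneous_of_mem_minimalPrimes {I p : Ideal R} (hI : I.IsHomogeneous 𝓡)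
    (hp : p ∈ I.minimalPrimes) : p.IsHomogeneous 𝓡 := by
  have := hp.1.1
  have hcore : (p.homogeneousCore 𝓡).toIdeal.IsPrime := Ideal.IsPrime.homogeneousCore hp.1.1
  have hle : I ≤ (p.homogeneousCore 𝓡).toIdeal := by
    rw [← hI.toIdeal_homogeneousCore_eq_self]
    exact Ideal.homogeneousCore_mono 𝓡 hp.1.2
  rw [Ideal.IsHomogeneous.iff_eq]
  exact le_antisymm (Ideal.toIdeal_homogeneousCore_le 𝓡 p)
    (hp.2 ⟨hcore, hle⟩ (Ideal.toIdeal_homogeneousCore_le 𝓡 p))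

theorem mem_degree_zero_iff (hpow : ∀ t, 𝓡 t = 𝓡 1 ^ t) {a : R} : a ∈ 𝓡 0 ↔ ∃ c : k, algebraMap k R c = a := by
  rw [hpow 0, pow_zero, Submodule.mem_one]

theorem degree_le_span_pow (hpow : ∀ t, 𝓡 t = 𝓡 1 ^ t) (t : ℕ) :
    (𝓡 t : Set R) ⊆ (Ideal.span (𝓡 1 : Set R) ^ t : Ideal R) := by
  intro a ha
  rw [SetLike.mem_coe, hpow t] at ha
  refine Submodule.pow_induction_on_left' (𝓡 1)
    (C := fun t a _ => a ∈ Ideal.span (𝓡 1 : Set R) ^ t) ?_ ?_ ?_ ha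
  · intro r
    simp
  · intro x y i _ _ hx hy
    exact add_mem hx hy
  · intro m hm i x _ hx
    rw [pow_succ']
    exact Ideal.mul_mem_mul (Ideal.subset_span hm) hx

/-- A proper homogeneous ideal is contained in the ideal generated in degree one. -/
theorem le_span_degree_one_of_isHomogeneous (hpow : ∀ t, 𝓡 t = 𝓡 1 ^ t) {p : Ideal R}
    (hp : p.IsHomogeneous 𝓡) (hne : p ≠ ⊤) :
    p ≤ Ideal.span (𝓡 1 : Set R) := by
  classical
  intro a ha
  rw [← DirectSum.sum_support_decompose 𝓡 a]
  refine sum_mem fun i _ => ?_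
  have hi : (DirectSum.decompose 𝓡 a i : R) ∈ p := hp i ha
  have hmem := (DirectSum.decompose 𝓡 a i).2
  generalize (DirectSum.decompose 𝓡 a i : R) = b at hi hmem
  rcases Nat.eq_zero_or_pos i with rfl | hpos
  · obtain ⟨c, rfl⟩ := (mem_degree_zero_iff 𝓡 hpow).1 hmem
    by_cases hc : c = 0
    · simp [hc]
    · exact absurd (Ideal.eq_top_of_isUnit_mem p hi ((IsUnit.mk0 c hc).map _)) hne
  · exact Ideal.pow_le_self hpos.ne' (degree_le_span_pow 𝓡 hpow i hmem)

/-- The homogeneous elements of an ideal generated in degree one. -/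
theorem mem_of_mem_span_degree_one {F : Set R} (hF : F ⊆ 𝓡 1) {t : ℕ} (T : AddSubmonoid R)
    (hT : ∀ f ∈ F, ∀ b ∈ 𝓡 t, f * b ∈ T) {a : R} (ha : a ∈ Ideal.span F) (hat : a ∈ 𝓡 (t + 1)) :
    a ∈ T := by
  -- The multiplier `r` lets the span induction absorb scalars from `R`; only `r = 1` is needed at
  -- the end.
  have key : ∀ b ∈ Ideal.span F, ∀ r : R, (DirectSum.decompose 𝓡 (r * b) (t + 1) : R) ∈ T := by
    intro b hb
    refine Submodule.span_induction (p := fun b _ =>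
      ∀ r : R, (DirectSum.decompose 𝓡 (r * b) (t + 1) : R) ∈ T) ?_ (by simp) ?_ ?_ hb
    · intro f hf r
      rw [mul_comm, add_comm,
        DirectSum.coe_decompose_mul_add_of_left_mem 𝓡 (i := 1) (j := t) (hF hf)]
      exact hT f hf _ (DirectSum.decompose 𝓡 r t).2
    · intro x y _ _ hx hy r
      simpa [mul_add, DirectSum.decompose_add] using add_mem (hx r) (hy r)
    · intro c x _ hx r
      rw [smul_eq_mul, ← mul_assoc]
      exact hx _
  simpa [DirectSum.decompose_of_mem_same 𝓡 hat] using key a ha 1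

/-- The degree-one part of a Noetherian standard graded algebra is finite-dimensional. -/
theorem fg_degree_one [IsNoetherianRing R] (hpow : ∀ t, 𝓡 t = 𝓡 1 ^ t) : (𝓡 1).FG := by
  obtain ⟨F, hF, hspan⟩ := (Submodule.fg_span_iff_fg_span_finset_subset (R := R)
    (𝓡 1 : Set R)).1 (IsNoetherian.noetherian _)
  refine ⟨F, le_antisymm (Submodule.span_le.2 hF) fun a ha => ?_⟩
  refine mem_of_mem_span_degree_one 𝓡 hF (t := 0) (Submodule.span k (F : Set R)).toAddSubmonoid
    ?_ ?_ ha
  · intro f hf b hb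
    obtain ⟨c, rfl⟩ := (mem_degree_zero_iff 𝓡 hpow).1 hb
    rw [mul_comm, ← Algebra.smul_def]
    exact Submodule.smul_mem _ _ (Submodule.subset_span hf)
  · exact hspan.le (Submodule.subset_span ha)

/-- Graded Nakayama lemma: finiteness over the subalgebra generated by degree-one elements. -/
theorem aeval_finite_of_degree_one_le_radical [IsNoetherianRing R] (hpow : ∀ t, 𝓡 t = 𝓡 1 ^ t)
    {σ : Type*} {y : σ → R} (hy : ∀ j, y j ∈ 𝓡 1)
    (hrad : (𝓡 1 : Set R) ⊆ (Ideal.span (Set.range y)).radical) :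
    (MvPolynomial.aeval y : MvPolynomial σ k →ₐ[k] R).Finite := by
  set C := MvPolynomial σ k
  set φ : C →ₐ[k] R := MvPolynomial.aeval y
  obtain ⟨N, hN⟩ := Ideal.exists_pow_le_of_le_radical_of_fg (Ideal.span_le.2 hrad)
    (IsNoetherian.noetherian _)
  have hFG : ∀ t, (𝓡 t).FG := fun t => by
    rw [hpow t]
    exact (fg_degree_one 𝓡 hpow).pow t
  choose G hG using hFG
  algebraize [φ.toRingHom]
  -- Generators in degrees at most `N` suffice: any higher degree lies in the ideal `(y)`, so its
  -- elements are sums of `y j * b` with `b` one degree lower.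
  let T : Submodule C R := Submodule.span C (⋃ t ∈ Finset.range (N + 1), (G t : Set R))
  have hTk : ∀ (c : k) (a : R), a ∈ T → c • a ∈ T := by
    intro c a ha
    have : c • a = (MvPolynomial.C c : C) • a := by
      rw [RingHom.smul_toAlgebra, Algebra.smul_def]
      congr 1
      exact (φ.commutes c).symm
    rw [this]
    exact T.smul_mem _ ha
  have hT : ∀ t, ∀ a ∈ 𝓡 t, a ∈ T := by
    intro t
    induction t using Nat.strong_induction_on with
    | _ t ih =>
      intro a ha
      by_cases ht : t < N + 1
      · rw [← hG t] at ha
        induction ha using Submodule.span_induction with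
        | mem x hx =>
          exact Submodule.subset_span (Set.mem_biUnion (Finset.mem_coe.2 (Finset.mem_range.2 ht)) hx)
        | zero => exact zero_mem _
        | add x y _ _ hx hy => exact add_mem hx hy
        | smul c x _ hx => exact hTk c x hx
      · obtain ⟨s, rfl⟩ : ∃ s, t = s + 1 := ⟨t - 1, by omega⟩
        refine mem_of_mem_span_degree_one 𝓡 (F := Set.range y) (Set.range_subset_iff.2 hy)
          T.toAddSubmonoid ?_ (hN (Ideal.pow_le_pow_right (by omega)
            (degree_le_span_pow 𝓡 hpow _ ha))) ha
        rintro _ ⟨j, rfl⟩ b hb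
        have : y j * b = (MvPolynomial.X j : C) • b := by
          rw [RingHom.smul_toAlgebra]
          congr 1
          exact (MvPolynomial.aeval_X y j).symm
        rw [this]
        exact T.smul_mem _ (ih s (by omega) b hb)
  have htop : T = ⊤ := by
    classical
    refine Submodule.eq_top_iff'.2 fun a => ?_
    rw [← DirectSum.sum_support_decompose 𝓡 a]
    exact sum_mem fun i _ => hT i _ (DirectSum.decompose 𝓡 a i).2
  refine Module.finite_def.2 (htop ▸ Submodule.fg_span ?_)
  exact Set.Finite.biUnion (Finset.finite_toSet _) fun t _ => (G t).finite_toSet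

theorem aeval_sub_aeval_mem {σ : Type*} {y z : σ → R} {I : Ideal R} (h : ∀ j, y j - z j ∈ I)
    (c : MvPolynomial σ k) : MvPolynomial.aeval y c - MvPolynomial.aeval z c ∈ I := by
  have : (Ideal.Quotient.mkₐ k I).comp (MvPolynomial.aeval y) =
      (Ideal.Quotient.mkₐ k I).comp (MvPolynomial.aeval z) := by
    refine MvPolynomial.algHom_ext fun j => ?_
    simpa using (Ideal.Quotient.mk_eq_mk_iff_sub_mem _ _).2 (h j)
  exact (Ideal.Quotient.mk_eq_mk_iff_sub_mem _ _).1 (DFunLike.congr_fun this c)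

theorem isMaximal_of_sub_algebraMap_mem {I : Ideal R} (hI : I ≠ ⊤)
    (h : ∀ a, ∃ c : k, a - algebraMap k R c ∈ I) : I.IsMaximal := by
  refine Ideal.isMaximal_iff.2 ⟨(Ideal.ne_top_iff_one I).1 hI, fun J a hIJ haI haJ => ?_⟩
  obtain ⟨c, hc⟩ := h a
  have hc0 : c ≠ 0 := by
    rintro rfl
    exact haI (by simpa using hc)
  have hcJ : algebraMap k R c ∈ J := by simpa using sub_mem haJ (hIJ hc)
  exact (Ideal.eq_top_iff_one J).1 (J.eq_top_of_isUnit_mem hcJ ((IsUnit.mk0 c hc0).map _))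

theorem span_degree_one_ne_top [Nontrivial R] : Ideal.span (𝓡 1 : Set R) ≠ ⊤ := by
  have hle : Ideal.span (𝓡 1 : Set R) ≤ (HomogeneousIdeal.irrelevant 𝓡).toIdeal :=
    Ideal.span_le.2 fun a ha => HomogeneousIdeal.mem_irrelevant_of_mem 𝓡 one_pos ha
  intro h
  have h1 := hle (h ▸ Submodule.mem_top (x := (1 : R)))
  rw [HomogeneousIdeal.mem_iff, HomogeneousIdeal.mem_irrelevant_iff, GradedRing.proj_apply,
    DirectSum.decompose_of_mem_same 𝓡 SetLike.GradedOne.one_mem] at h1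
  exact one_ne_zero h1

/-- A minimal prime over `(y)` contracts to the ideal of all variables, which is maximal, so by
integrality it is maximal. Being homogeneous, it lies in the proper ideal generated by degree one,
hence equals it. -/
theorem degree_one_le_radical_of_aeval_finite (hpow : ∀ t, 𝓡 t = 𝓡 1 ^ t)
    {σ : Type*} {y : σ → R} (hy : ∀ j, y j ∈ 𝓡 1)
    (hfin : (MvPolynomial.aeval y : MvPolynomial σ k →ₐ[k] R).Finite) :
    (𝓡 1 : Set R) ⊆ (Ideal.span (Set.range y)).radical := by
  intro a ha
  rw [SetLike.mem_coe, ← Ideal.sInf_minimalPrimes, Submodule.mem_sInf]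
  intro p hp
  have hprime := hp.1.1
  have : Nontrivial R := ⟨⟨0, 1, fun h => hprime.one_notMem (h ▸ p.zero_mem)⟩⟩
  have hhom : p.IsHomogeneous 𝓡 := isHomogeneous_of_mem_minimalPrimes 𝓡
    (isHomogeneous_span_of_degree_one 𝓡 (by rintro _ ⟨j, rfl⟩; exact hy j)) hp
  have hle := le_span_degree_one_of_isHomogeneous 𝓡 hpow hhom hprime.ne_top
  have hmax : Ideal.IsMaximal p := by
    refine Ideal.isMaximal_of_isIntegral_of_isMaximal_comap'
      (MvPolynomial.aeval y : MvPolynomial σ k →ₐ[k] R).toRingHom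
      (RingHom.Finite.to_isIntegral hfin) p ?_
    refine isMaximal_of_sub_algebraMap_mem (k := k) (Ideal.comap_ne_top _ hprime.ne_top)
      fun c => ⟨MvPolynomial.constantCoeff c, ?_⟩
    have := aeval_sub_aeval_mem (k := k) (y := y) (z := 0) (I := p)
      (fun j => by simpa using hp.1.2 (Ideal.subset_span (Set.mem_range_self j))) c
    rw [MvPolynomial.aeval_zero] at this
    rw [Ideal.mem_comap, map_sub]
    simpa [MvPolynomial.algebraMap_eq] using this
  rw [hmax.eq_of_le (span_degree_one_ne_top 𝓡) hle]
  exact Ideal.subset_span ha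

/-- If `R` is integral over `k[x]`, a chain of primes of `R` containing all but one of the `x j`
has length at most one. -/
theorem not_lt_of_lt_of_forall_ne_mem {σ : Type*} {x : σ → R} (l : σ)
    (hint : (MvPolynomial.aeval x : MvPolynomial σ k →ₐ[k] R).toRingHom.IsIntegral)
    {q p m : Ideal R} [q.IsPrime] [p.IsPrime] [m.IsPrime] (hq : ∀ j, j ≠ l → x j ∈ q)
    (hqp : q < p) : ¬ p < m := by
  classical
  intro hpm
  let f : Polynomial k →ₐ[k] R := Polynomial.aeval (x l)
  have hcomap : ∀ {I J : Ideal R} [I.IsPrime], (∀ j, j ≠ l → x j ∈ I) → I < J →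
      I.comap f < J.comap f := by
    intro I J _ hI hIJ
    obtain ⟨hle, a, haJ, haI⟩ := SetLike.lt_iff_le_and_exists.1 hIJ
    algebraize [(MvPolynomial.aeval x : MvPolynomial σ k →ₐ[k] R).toRingHom]
    obtain ⟨-, c, hcJ, hcI⟩ := SetLike.lt_iff_le_and_exists.1
      (Ideal.comap_lt_comap_of_integral_mem_sdiff hle ⟨haJ, haI⟩ (hint a))
    change MvPolynomial.aeval x c ∈ J at hcJ
    change MvPolynomial.aeval x c ∉ I at hcI
    -- Killing the variables other than `l` changes the value of `c` only by an element of `I`, so a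
    -- strict inclusion seen in `k[x]` is already seen in `k[T]`.
    let g : Polynomial k := MvPolynomial.aeval (fun j => if j = l then Polynomial.X else 0) c
    have hg : MvPolynomial.aeval x c - f g ∈ I := by
      have : f g = MvPolynomial.aeval (fun j => f (if j = l then Polynomial.X else 0)) c :=
        MvPolynomial.comp_aeval_apply _ _ _
      rw [this]
      refine aeval_sub_aeval_mem (fun j => ?_) c
      by_cases hj : j = l
      · simp [hj, f]
      · simpa [hj] using hI j hj
    refine SetLike.lt_iff_le_and_exists.2 ⟨Ideal.comap_mono hle, g, ?_, fun h => hcI ?_⟩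
    · simpa using sub_mem hcJ (hle hg)
    · simpa using add_mem hg (show f g ∈ I from h)
  have h1 := hcomap hq hqp
  have h2 := hcomap (fun j hj => hqp.le (hq j hj)) hpm
  -- Nonzero primes of the principal ideal domain `k[T]` are maximal.
  have hmax : (p.comap f).IsMaximal := (p.comap_isPrime f).isMaximal (bot_le.trans_lt h1).ne'
  exact h2.ne (hmax.eq_of_le (Ideal.IsPrime.ne_top (m.comap_isPrime f)) h2.le)

/-- Exchange criterion: one element of a homogeneous system of parameters may be replaced by `Y`
as soon as `Y` avoids the relevant minimal primes over the remaining elements. -/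
theorem degree_one_le_radical_insert (hpow : ∀ t, 𝓡 t = 𝓡 1 ^ t) {σ : Type*} {x : σ → R}
    (hx : ∀ j, x j ∈ 𝓡 1) (l : σ)
    (hint : (MvPolynomial.aeval x : MvPolynomial σ k →ₐ[k] R).toRingHom.IsIntegral)
    {Y : R} (hY : Y ∈ 𝓡 1)
    (hmin : ∀ q ∈ (Ideal.span (x '' {l}ᶜ)).minimalPrimes, ¬ (𝓡 1 : Set R) ⊆ q → Y ∉ q) :
    (𝓡 1 : Set R) ⊆ (Ideal.span (insert Y (x '' {l}ᶜ))).radical := by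
  intro a ha
  rw [SetLike.mem_coe, ← Ideal.sInf_minimalPrimes, Submodule.mem_sInf]
  intro p hp
  have hprime := hp.1.1
  have : Nontrivial R := ⟨⟨0, 1, fun h => hprime.one_notMem (h ▸ p.zero_mem)⟩⟩
  by_contra hap
  have hhom : p.IsHomogeneous 𝓡 := by
    refine isHomogeneous_of_mem_minimalPrimes 𝓡 (isHomogeneous_span_of_degree_one 𝓡 ?_) hp
    rintro _ (rfl | ⟨j, -, rfl⟩)
    exacts [hY, hx j]
  have hle := le_span_degree_one_of_isHomogeneous 𝓡 hpow hhom hprime.ne_top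
  obtain ⟨m, hm, hle'⟩ := Ideal.exists_le_maximal _ (span_degree_one_ne_top 𝓡)
  obtain ⟨q, hq, hqp⟩ := Ideal.exists_minimalPrimes_le
    ((Ideal.span_mono (Set.subset_insert Y _)).trans hp.1.2)
  have hqprime := hq.1.1
  have hmprime := hm.isPrime
  have hYp : Y ∈ p := hp.1.2 (Ideal.subset_span (Set.mem_insert _ _))
  -- A relevant `p` would give a forbidden chain `q < p < m`: `Y` separates `q` from `p`, and degree
  -- one separates `p` from `m`.
  refine not_lt_of_lt_of_forall_ne_mem l hint (q := q) (p := p) (m := m)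
    (fun j hj => hq.1.2 (Ideal.subset_span ⟨j, hj, rfl⟩)) (hqp.lt_of_ne ?_)
    ((hle.trans hle').lt_of_ne ?_)
  · rintro rfl
    exact hmin q hq (fun h => hap (h ha)) hYp
  · rintro rfl
    exact hap (hle' (Ideal.subset_span ha))

end StandardGraded

/-! ### The diagonal subring, its grading and its primes -/

section Diagonal

variable {k S : Type*} [Field k] [CommRing S] [Algebra k S] {n : ℕ}
  (𝒜 : (Fin n → ℕ) → Submodule k S) [GradedAlgebra 𝒜]

theorem prod_le_graded {ι : Type*} (s : Finset ι) (c : ι → Fin n → ℕ) :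
    ∏ i ∈ s, 𝒜 (c i) ≤ 𝒜 (∑ i ∈ s, c i) := by
  classical
  induction s using Finset.induction_on with
  | empty =>
    rw [Finset.prod_empty, Finset.sum_empty, Submodule.one_le]
    exact SetLike.GradedOne.one_mem
  | insert i s hi ih =>
    rw [Finset.prod_insert hi, Finset.sum_insert hi]
    exact (mul_le_mul_right ih _).trans
      (Submodule.mul_le.2 fun a ha b hb => SetLike.GradedMul.mul_mem ha hb)

/-- The products on the left form a multiplicative family inside `𝒜` containing the generators, so
they span `S` and must fill each component. -/
theorem IsStandard.eq_prod_pow {𝒜 : (Fin n → ℕ) → Submodule k S} [GradedAlgebra 𝒜]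
    (hS : IsStandard 𝒜) (a : Fin n → ℕ) : ∏ i, unitPart 𝒜 i ^ a i = 𝒜 a := by
  let U : (Fin n → ℕ) → Submodule k S := fun a => ∏ i, unitPart 𝒜 i ^ a i
  have : SetLike.GradedMonoid U :=
    { one_mem := by simp [U, Submodule.one_le.1 le_rfl]
      mul_mem := fun i j x y hx hy => by
        have := Submodule.mul_mem_mul hx hy
        simpa only [U, Pi.add_apply, pow_add, Finset.prod_mul_distrib] using this }
  have hle : ∀ a, U a ≤ 𝒜 a := by
    intro a
    have hpow : ∀ i (m : ℕ), unitPart 𝒜 i ^ m ≤ 𝒜 (Pi.single i m) := by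
      intro i m
      have := prod_le_graded 𝒜 (Finset.range m) fun _ => Pi.single i 1
      rwa [Finset.prod_const, Finset.sum_const, Finset.card_range, ← Pi.single_smul,
        smul_eq_mul, mul_one] at this
    have := prod_le_graded 𝒜 Finset.univ fun i => Pi.single i (a i)
    rw [Finset.univ_sum_single] at this
    exact (Finset.prod_le_prod' fun i _ => hpow i (a i)).trans this
  refine eq_of_le_of_iSup_eq_top 𝒜 hle (iSup_eq_top_of_adjoin_eq_top U hS.generated ?_) a
  intro g hg
  obtain ⟨i, hi⟩ := Set.mem_iUnion.1 hg
  refine ⟨Pi.single i 1, ?_⟩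
  have : U (Pi.single i 1) = unitPart 𝒜 i := by
    simp only [U]
    rw [Finset.prod_eq_single i]
    · simp
    · intro j _ hj
      simp [hj]
    · simp
  rwa [this]

/-- For a standard graded algebra, `S_(t,…,t)` lies in the diagonal subring. -/
theorem IsStandard.le_diagonal {𝒜 : (Fin n → ℕ) → Submodule k S} [GradedAlgebra 𝒜]
    (hS : IsStandard 𝒜) (t : ℕ) :
    𝒜 (fun _ => t) ≤ Subalgebra.toSubmodule (diagonal 𝒜) := by
  have h1 : ∏ i, unitPart 𝒜 i ≤ Subalgebra.toSubmodule (diagonal 𝒜) := by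
    have := hS.eq_prod_pow (fun _ => 1)
    simp only [pow_one] at this
    rw [this]
    exact Algebra.subset_adjoin
  rw [← hS.eq_prod_pow (fun _ => t), Finset.prod_pow]
  generalize ∏ i, unitPart 𝒜 i = V at h1
  induction t with
  | zero =>
    rw [pow_zero, Submodule.one_le]
    exact one_mem (diagonal 𝒜)
  | succ t ih =>
    rw [pow_succ, Submodule.mul_le]
    exact fun a ha b hb => mul_mem (S := Subalgebra k S) (ih ha) (h1 hb)

/-- The degree-`t` part `S_(t,…,t)` of the diagonal subring. -/
def diagonalPart (t : ℕ) : Submodule k (diagonal 𝒜) :=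
  (𝒜 fun _ => t).comap (diagonal 𝒜).val.toLinearMap

instance diagonalPart_gradedMonoid : SetLike.GradedMonoid (diagonalPart 𝒜) where
  one_mem := SetLike.GradedOne.one_mem (A := 𝒜)
  mul_mem _ _ _ _ hx hy := SetLike.GradedMul.mul_mem (A := 𝒜) hx hy

theorem adjoin_diagonalPart_one : Algebra.adjoin k (diagonalPart 𝒜 1 : Set (diagonal 𝒜)) = ⊤ :=
  Algebra.adjoin_adjoin_coe_preimage

/-- For `n ≠ 0` the map t ↦ (t,…,t) is injective, so independence is inherited from `𝒜`. -/
theorem diagonalPart_isInternal (hn : n ≠ 0) : DirectSum.IsInternal (diagonalPart 𝒜) := by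
  refine DirectSum.isInternal_submodule_of_iSupIndep_of_iSup_eq_top ?_
    (iSup_eq_top_of_adjoin_eq_top _ (adjoin_diagonalPart_one 𝒜) fun g hg => ⟨1, hg⟩)
  have hinj : Function.Injective fun t : ℕ => (fun _ => t : Fin n → ℕ) := fun s t h =>
    congrFun h ⟨0, Nat.pos_of_ne_zero hn⟩
  have hind : iSupIndep fun t : ℕ => 𝒜 fun _ => t :=
    (DirectSum.Decomposition.isInternal 𝒜).submodule_iSupIndep.comp hinj
  rw [iSupIndep_iff_finsetSum_eq_zero_imp_eq_zero] at hind ⊢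
  intro s v hv hsum t ht
  refine Subtype.ext (hind s (fun t => (v t : S)) (fun t ht => hv t ht) ?_ t ht)
  simpa using congrArg (diagonal 𝒜).val hsum

/-- The `ℕ`-grading of the diagonal subring. -/
noncomputable abbrev diagonalGradedAlgebra (hn : n ≠ 0) : GradedAlgebra (diagonalPart 𝒜) where
  toDecomposition := (diagonalPart_isInternal 𝒜 hn).chooseDecomposition

theorem diagonalPart_eq_pow (hn : n ≠ 0) (t : ℕ) :
    diagonalPart 𝒜 t = diagonalPart 𝒜 1 ^ t := by
  let _ := diagonalGradedAlgebra 𝒜 hn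
  refine (eq_of_le_of_iSup_eq_top (diagonalPart 𝒜) (U := fun t => diagonalPart 𝒜 1 ^ t) ?_ ?_ t).symm
  · intro t
    induction t with
    | zero =>
      simp only [pow_zero, Submodule.one_le]
      exact SetLike.GradedOne.one_mem
    | succ t ih =>
      simp only [pow_succ, Submodule.mul_le]
      exact fun a ha b hb => SetLike.GradedMul.mul_mem (ih ha) hb
  · exact iSup_eq_top_of_adjoin_eq_top _ (adjoin_diagonalPart_one 𝒜) fun g hg => ⟨1, by simpa using hg⟩

/-- The elements `s` with `s * S_((1,…,1) - e_i) ⊆ q`. -/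
def primeSection (q : Ideal (diagonal 𝒜)) (i : Fin n) : Submodule k S :=
  ⨅ t ∈ 𝒜 ((fun _ => 1) - Pi.single i 1),
    ((q.restrictScalars k).map (diagonal 𝒜).val.toLinearMap).comap (LinearMap.mulRight k t)

variable {𝒜} in
theorem mem_primeSection {q : Ideal (diagonal 𝒜)} {i : Fin n} {s : S} :
    s ∈ primeSection 𝒜 q i ↔
      ∀ t ∈ 𝒜 ((fun _ => 1) - Pi.single i 1), ∃ r ∈ q, (r : S) = s * t := by
  simp [primeSection]

/-- A product of elements of the `S^(i)` lies in a prime of the diagonal subring if and only if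
one of the factors lies in the corresponding linear subspace. -/
theorem IsStandard.prod_mem_prime_iff {𝒜 : (Fin n → ℕ) → Submodule k S} [GradedAlgebra 𝒜]
    (hS : IsStandard 𝒜) (q : Ideal (diagonal 𝒜)) [hq : q.IsPrime] {s : Fin n → S}
    (hs : ∀ i, s i ∈ unitPart 𝒜 i) {r : diagonal 𝒜} (hr : (r : S) = ∏ i, s i) :
    r ∈ q ↔ ∃ i, s i ∈ primeSection 𝒜 q i := by
  classical
  constructor
  · intro hrq
    by_contra! hcon
    simp only [mem_primeSection, not_forall] at hcon
    choose t ht hst using hcon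
    have hone : ∀ i, s i * t i ∈ 𝒜 fun _ => 1 := by
      intro i
      have := SetLike.GradedMul.mul_mem (A := 𝒜) (hs i) (ht i)
      convert this using 2
      ext j
      by_cases hj : j = i
      · subst hj; simp
      · simp [hj]
    have hT : ∏ i, t i ∈ 𝒜 fun _ => n - 1 := by
      have := SetLike.prod_mem_graded 𝒜 _ t (F := Finset.univ) (fun i _ => ht i)
      convert this using 2
      ext j
      have hsum : (∑ i : Fin n, (1 - (Pi.single i 1 : Fin n → ℕ) j)) +
          ∑ i : Fin n, (Pi.single i 1 : Fin n → ℕ) j = n := by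
        rw [← Finset.sum_add_distrib, Finset.sum_congr rfl (g := fun _ => 1)]
        · simp
        · intro i _
          by_cases hj : j = i
          · subst hj; simp
          · simp [hj]
      have hone : ∑ i : Fin n, (Pi.single i 1 : Fin n → ℕ) j = 1 := by simp [Pi.single_apply]
      rw [Finset.sum_apply]
      simp only [Pi.sub_apply]
      omega
    let u : Fin n → diagonal 𝒜 := fun i => ⟨s i * t i, hS.le_diagonal 1 (hone i)⟩
    -- The cofactors `t i` have degree (1,…,1) - e_i, so their product has diagonal degree
    -- (n-1,…,n-1) and stays in the ring where `q` is prime.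
    have hu : ∏ i, u i = r * ⟨∏ i, t i, hS.le_diagonal (n - 1) hT⟩ := by
      apply Subtype.ext
      simp [u, hr, Finset.prod_mul_distrib]
    have huq : ∏ i, u i ∈ q := hu ▸ q.mul_mem_right _ hrq
    obtain ⟨i, -, hi⟩ := (hq.prod_mem_iff).1 huq
    exact hst i ⟨u i, hi, rfl⟩
  · rintro ⟨i, hi⟩
    have ht : ∏ j ∈ Finset.univ.erase i, s j ∈ 𝒜 ((fun _ => 1) - Pi.single i 1) := by
      have := SetLike.prod_mem_graded 𝒜 (fun j : Fin n => (Pi.single j 1 : Fin n → ℕ)) s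
        (F := Finset.univ.erase i) (fun j _ => hs j)
      convert this using 2
      rw [eq_comm, ← Finset.univ_sum_single (fun _ : Fin n => (1 : ℕ)),
        ← Finset.add_sum_erase _ _ (Finset.mem_univ i), add_tsub_cancel_left]
    obtain ⟨r', hr', h⟩ := mem_primeSection.1 hi _ ht
    rw [Finset.mul_prod_erase _ _ (Finset.mem_univ i), ← hr] at h
    rwa [← Subtype.ext h]

end Diagonal

/-! ### Zariski-closedness of finite unions of subspaces -/

section Zariski

variable {k : Type*} [Field k] {d : ℕ}

/-- A point outside `V` is separated from it by a linear functional, which is a polynomial in the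
coordinates. -/
theorem isZariskiClosed_submodule (V : Submodule k (Fin d → k)) :
    IsZariskiClosed (V : Set (Fin d → k)) := by
  refine ⟨{p | ∀ v ∈ V, MvPolynomial.eval v p = 0}, Set.ext fun v =>
    ⟨fun hv p hp => hp v hv, fun h => ?_⟩⟩
  by_contra hv
  obtain ⟨f, hfv, hf⟩ := Submodule.exists_le_ker_of_notMem hv
  have heval : ∀ u, MvPolynomial.eval u
      (∑ i, MvPolynomial.X i * MvPolynomial.C (f (Pi.single i 1))) = f u := by
    intro u
    have hsum := congrArg f (Finset.univ_sum_single u)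
    rw [map_sum] at hsum
    rw [← hsum, map_sum]
    refine Finset.sum_congr rfl fun i _ => ?_
    rw [map_mul, MvPolynomial.eval_X, MvPolynomial.eval_C, ← smul_eq_mul, ← map_smul,
      ← Pi.single_smul, smul_eq_mul, mul_one]
  refine hfv ?_
  rw [← heval]
  exact h _ fun u hu => (heval u).trans (hf hu)

theorem IsZariskiClosed.union {M N : Set (Fin d → k)} (hM : IsZariskiClosed M)
    (hN : IsZariskiClosed N) : IsZariskiClosed (M ∪ N) := by
  obtain ⟨P, rfl⟩ := hM
  obtain ⟨Q, rfl⟩ := hN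
  refine ⟨Set.image2 (· * ·) P Q, Set.ext fun v => ⟨?_, fun h => ?_⟩⟩
  · rintro (h | h) _ ⟨p, hp, q, hq, rfl⟩
    · simp [h p hp]
    · simp [h q hq]
  · by_contra hcon
    simp only [Set.mem_union, Set.mem_ofPred_eq, not_or, not_forall] at hcon
    obtain ⟨⟨p, hp, hp0⟩, q, hq, hq0⟩ := hcon
    have := h _ ⟨p, hp, q, hq, rfl⟩
    rw [map_mul] at this
    exact (mul_ne_zero hp0 hq0) this

theorem isZariskiClosed_biUnion (s : Finset (Submodule k (Fin d → k))) :
    IsZariskiClosed (⋃ V ∈ s, (V : Set (Fin d → k))) := by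
  classical
  induction s using Finset.induction_on with
  | empty => exact ⟨{1}, by simp⟩
  | insert V s _ ih =>
    rw [Finset.set_biUnion_insert]
    exact (isZariskiClosed_submodule V).union ih

end Zariski

/-! ### Complete reductions as radical conditions -/

theorem inclusion_adjoin_range_finite_iff {k S σ : Type*} [Field k] [CommRing S] [Algebra k S]
    {D : Subalgebra k S} (g : σ → D) (h : Algebra.adjoin k (Set.range fun j => (g j : S)) ≤ D) :
    (Subalgebra.inclusion h).Finite ↔
      (MvPolynomial.aeval g : MvPolynomial σ k →ₐ[k] D).Finite := by
  let π : MvPolynomial σ k →ₐ[k] Algebra.adjoin k (Set.range fun j => (g j : S)) :=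
    MvPolynomial.aeval fun j => ⟨g j, Algebra.subset_adjoin ⟨j, rfl⟩⟩
  have hcomp : (Subalgebra.inclusion h).comp π = MvPolynomial.aeval g :=
    MvPolynomial.algHom_ext fun j => by
      apply Subtype.ext
      simp [π]
  have hsurj : Function.Surjective π := by
    rintro ⟨a, ha⟩
    rw [Algebra.adjoin_range_eq_range_aeval] at ha
    obtain ⟨c, rfl⟩ := ha
    refine ⟨c, Subtype.ext ?_⟩
    exact MvPolynomial.comp_aeval_apply _
      (Algebra.adjoin k (Set.range fun j => (g j : S))).val c
  rw [← hcomp]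
  exact ⟨fun hf => hf.comp (AlgHom.Finite.of_surjective π hsurj), AlgHom.Finite.of_comp_finite⟩

/-- The `j`-th column product, as an element of the diagonal subring. -/
def columnProd {k S : Type*} [Field k] [CommRing S] [Algebra k S] {n r : ℕ}
    (𝒜 : (Fin n → ℕ) → Submodule k S) [GradedAlgebra 𝒜] (x : Fin n → Fin r → S)
    (hx : ∀ i j, x i j ∈ unitPart 𝒜 i) (j : Fin r) : diagonal 𝒜 :=
  ⟨∏ i, x i j, columnAlgebra_le_diagonal 𝒜 x hx (Algebra.subset_adjoin ⟨j, rfl⟩)⟩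

section Column

variable {k S : Type*} [Field k] [CommRing S] [Algebra k S] {n r : ℕ}
  (𝒜 : (Fin n → ℕ) → Submodule k S) [GradedAlgebra 𝒜]

theorem columnProd_mem_diagonalPart {x : Fin n → Fin r → S}
    (hx : ∀ i j, x i j ∈ unitPart 𝒜 i) (j : Fin r) :
    columnProd 𝒜 x hx j ∈ diagonalPart 𝒜 1 := by
  have h := SetLike.prod_mem_graded 𝒜 (fun i : Fin n => (Pi.single i 1 : Fin n → ℕ))
    (fun i => x i j) (F := Finset.univ) (fun i _ => hx i j)
  rw [Finset.univ_sum_single (fun _ : Fin n => (1 : ℕ))] at h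
  exact h

theorem isCompleteReduction_iff_aeval_finite {x : Fin n → Fin r → S}
    (hx : ∀ i j, x i j ∈ unitPart 𝒜 i) :
    IsCompleteReduction 𝒜 x ↔
      (MvPolynomial.aeval (columnProd 𝒜 x hx) :
        MvPolynomial (Fin r) k →ₐ[k] diagonal 𝒜).Finite := by
  rw [← inclusion_adjoin_range_finite_iff (columnProd 𝒜 x hx) (columnAlgebra_le_diagonal 𝒜 x hx)]
  exact ⟨fun ⟨_, h⟩ => h, fun h => ⟨hx, h⟩⟩

theorem IsCompleteReduction.isNoetherianRing {𝒜 : (Fin n → ℕ) → Submodule k S} [GradedAlgebra 𝒜]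
    {x : Fin n → Fin r → S} (h : IsCompleteReduction 𝒜 x) : IsNoetherianRing (diagonal 𝒜) := by
  have hfin := (isCompleteReduction_iff_aeval_finite 𝒜 h.1).1 h
  algebraize [(MvPolynomial.aeval (columnProd 𝒜 x h.1) :
    MvPolynomial (Fin r) k →ₐ[k] diagonal 𝒜).toRingHom]
  have : Module.Finite (MvPolynomial (Fin r) k) (diagonal 𝒜) := hfin
  exact IsNoetherianRing.of_finite (MvPolynomial (Fin r) k) (diagonal 𝒜)

/-- Complete reductions are the homogeneous systems whose zero locus is irrelevant. -/
theorem isCompleteReduction_iff_le_radical [IsNoetherianRing (diagonal 𝒜)] (hn : n ≠ 0)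
    {x : Fin n → Fin r → S} (hx : ∀ i j, x i j ∈ unitPart 𝒜 i) :
    IsCompleteReduction 𝒜 x ↔
      (diagonalPart 𝒜 1 : Set (diagonal 𝒜)) ⊆
        (Ideal.span (Set.range (columnProd 𝒜 x hx))).radical := by
  let _ := diagonalGradedAlgebra 𝒜 hn
  rw [isCompleteReduction_iff_aeval_finite 𝒜 hx]
  exact ⟨degree_one_le_radical_of_aeval_finite _ (diagonalPart_eq_pow 𝒜 hn)
      (columnProd_mem_diagonalPart 𝒜 hx),
    aeval_finite_of_degree_one_le_radical _ (diagonalPart_eq_pow 𝒜 hn)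
      (columnProd_mem_diagonalPart 𝒜 hx)⟩

theorem IsStandard.ringKrullDim_diagonal_le_zero {𝒜 : (Fin 0 → ℕ) → Submodule k S}
    [GradedAlgebra 𝒜] (hS : IsStandard 𝒜) : ringKrullDim (diagonal 𝒜) ≤ 0 := by
  have hsurj : Function.Surjective (algebraMap k (diagonal 𝒜)) := by
    rintro ⟨a, ha⟩
    have hle : diagonal 𝒜 ≤ ⊥ := by
      refine Algebra.adjoin_le ?_
      rw [Subsingleton.elim (fun _ => 1 : Fin 0 → ℕ) 0, hS.zero_part, Algebra.coe_bot]
    obtain ⟨c, hc⟩ := Algebra.mem_bot.1 (hle ha)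
    exact ⟨c, Subtype.ext hc⟩
  exact (ringKrullDim_le_of_surjective _ hsurj).trans (ringKrullDim_eq_zero_of_field k).le

end Column

end MultigradedExchange

/-! ### The exchange theorem -/

open MultigradedExchange in
theorem theorem5p2 {k S : Type*} [Field k] [Infinite k] [CommRing S] [Algebra k S] {n : ℕ}
    (𝒜 : (Fin n → ℕ) → Submodule k S) [GradedAlgebra 𝒜]
    (hS : MultigradedExchange.IsStandard 𝒜) (d : ℕ) (hd : 1 ≤ d)
    (hdim : ringKrullDim (MultigradedExchange.diagonal 𝒜) = (d : WithBot ℕ∞))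
    (x w : Fin n → Fin d → S)
    (hx : MultigradedExchange.IsCompleteReduction 𝒜 x)
    (hw : MultigradedExchange.IsCompleteReduction 𝒜 w) :
    ∃ M : Set (Fin d → k), MultigradedExchange.IsZariskiClosed M ∧ M ≠ Set.univ ∧
      ∀ v : Fin d → k,
        v ∉ M ↔ MultigradedExchange.IsCompleteReduction 𝒜
          (MultigradedExchange.exchangeLast x w v) := by
  classical
  -- For `n = 0` the diagonal subring is `k`, of dimension 0 < d.
  have hn : n ≠ 0 := by
    rintro rfl
    have := hdim ▸ hS.ringKrullDim_diagonal_le_zero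
    have : d ≤ 0 := by exact_mod_cast this
    omega
  have := hx.isNoetherianRing
  let _ := diagonalGradedAlgebra 𝒜 hn
  let l : Fin d := ⟨d - 1, by omega⟩
  have hl : ∀ j : Fin d, (j : ℕ) + 1 < d ↔ j ≠ l := fun j => by
    rw [Ne, Fin.ext_iff]
    have := j.2
    change _ ↔ ¬ (j : ℕ) = d - 1
    omega
  let X := columnProd 𝒜 x hx.1
  have hv : ∀ (v : Fin d → k) i j, exchangeLast x w v i j ∈ unitPart 𝒜 i := by
    intro v i j
    simp only [exchangeLast]
    split_ifs
    · exact hx.1 i j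
    · exact sum_mem fun h _ => Submodule.smul_mem _ _ (hw.1 i h)
  let Y := fun v => columnProd 𝒜 (exchangeLast x w v) (hv v) l
  have hrange : ∀ v, Set.range (columnProd 𝒜 (exchangeLast x w v) (hv v)) =
      insert (Y v) (X '' {l}ᶜ) := by
    intro v
    have hX : ∀ j ≠ l, columnProd 𝒜 (exchangeLast x w v) (hv v) j = X j := fun j hj =>
      Subtype.ext <|
      show ∏ i, exchangeLast x w v i j = ∏ i, x i j from
        Finset.prod_congr rfl fun i _ => if_pos ((hl j).2 hj)
    rw [← Set.image_univ, ← Set.insert_eq_of_mem (Set.mem_univ l), ← Set.union_compl_self {l},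
      Set.image_insert_eq, Set.image_union, Set.image_singleton, Set.singleton_union,
      Set.insert_idem]
    congr 1
    exact Set.image_congr hX
  let Q := {q ∈ (Ideal.span (X '' {l}ᶜ)).minimalPrimes |
    ¬ (diagonalPart 𝒜 1 : Set (diagonal 𝒜)) ⊆ q}
  have hQ : Q.Finite := (Ideal.finite_minimalPrimes_of_isNoetherianRing _ _).subset
    fun q hq => hq.1
  let V : Ideal (diagonal 𝒜) → Fin n → Submodule k (Fin d → k) := fun q i =>
    (primeSection 𝒜 q i).comap (Fintype.linearCombination k (w i))
  let s : Finset (Submodule k (Fin d → k)) := (hQ.image2 V Set.finite_univ).toFinset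
  have hYmem : ∀ v, ∀ q ∈ Q, Y v ∈ q ↔ ∃ i, v ∈ V q i := by
    intro v q hq
    have := hq.1.1.1
    rw [hS.prod_mem_prime_iff q (fun i => hv v i l) (r := Y v) rfl]
    refine exists_congr fun i => ?_
    have : exchangeLast x w v i l = Fintype.linearCombination k (w i) v := by
      rw [exchangeLast, if_neg (by rw [hl]; simp), Fintype.linearCombination_apply]
    rw [this]
    rfl
  have hmem : ∀ v, v ∈ ⋃ U ∈ s, (U : Set (Fin d → k)) ↔ ∃ q ∈ Q, Y v ∈ q := by
    intro v
    simp only [s, Set.Finite.mem_toFinset, Set.mem_iUnion, Set.mem_image2, SetLike.mem_coe,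
      exists_prop]
    constructor
    · rintro ⟨_, ⟨q, hq, i, -, rfl⟩, h⟩
      exact ⟨q, hq, (hYmem v q hq).2 ⟨i, h⟩⟩
    · rintro ⟨q, hq, h⟩
      obtain ⟨i, hi⟩ := (hYmem v q hq).1 h
      exact ⟨_, ⟨q, hq, i, trivial, rfl⟩, hi⟩
  refine ⟨⋃ U ∈ s, (U : Set (Fin d → k)), isZariskiClosed_biUnion s,
    Subspace.biUnion_ne_univ_of_top_notMem ?_, fun v => ?_⟩
  · intro htop
    obtain ⟨q, hq, i, -, hVi⟩ := (Set.Finite.mem_toFinset _).1 htop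
    have hqprime := hq.1.1.1
    refine hq.2 fun a ha => ?_
    refine (hqprime.radical_le_iff.2 (Ideal.span_le.2 ?_))
      ((isCompleteReduction_iff_le_radical 𝒜 hn hw.1).1 hw ha)
    rintro _ ⟨h, rfl⟩
    refine (hS.prod_mem_prime_iff q (fun i => hw.1 i h) rfl).2 ⟨i, ?_⟩
    -- Evaluating at a basis vector isolates the single entry `w i h`.
    have hsingle : Pi.single h 1 ∈ V q i := hVi ▸ Submodule.mem_top
    have : Fintype.linearCombination k (w i) (Pi.single h 1) ∈ primeSection 𝒜 q i := hsingle
    simpa using this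
  · rw [isCompleteReduction_iff_le_radical 𝒜 hn (hv v), hrange, hmem]
    constructor
    · intro h
      refine degree_one_le_radical_insert _ (diagonalPart_eq_pow 𝒜 hn)
        (columnProd_mem_diagonalPart 𝒜 hx.1) l
        (RingHom.Finite.to_isIntegral ((isCompleteReduction_iff_aeval_finite 𝒜 hx.1).1 hx))
        (columnProd_mem_diagonalPart 𝒜 (hv v) l) fun q hq hrel hYq => h ⟨q, ⟨hq, hrel⟩, hYq⟩
    · rintro h ⟨q, hq, hYq⟩
      have hqprime := hq.1.1.1
      refine hq.2 (h.trans (hqprime.radical_le_iff.2 (Ideal.span_le.2 ?_)))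
      exact Set.insert_subset hYq (Ideal.span_le.1 hq.1.1.2)
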